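/- Let $\Sigma$ be an alphabet and let $\mathcal S$ be the set of symbols generated inductively by $\Sigma\subseteq\mathcal S$, $(S_1,S_2)\in\mathcal S$ for $S_1,S_2\in\mathcal S$, and $(S,k)\in\mathcal S$ for $S\in\mathcal S$ and integers $k\ge 2$; let $\mathrm{str}(S)$ be the string over $\Sigma$ generated by $S$. Fix bits $h_i(S)\in\{0,1\}$ for $i\ge 1$, $S\in\mathcal S$. For a string $u$ over $\mathcal S$, $\mathrm{Rle}(u)$ is obtained from $u$ by replacing every maximal block of $k\ge 2$ equal adjacent symbols $S$ by $(S,k)$, and $\mathrm{Compress}_i(u)$ by replacing every block of two adjacent symbols $S_1S_2$ with $h_i(S_1)=0$, $h_i(S_2)=1$ by $(S_1,S_2)$ (all other symbols form one-symbol blocks and are kept). For a non-empty string $w$ over $\Sigma$ put $w_0=w$ and, for $l\ge 0$, $w_{l+1}=\mathrm{Rle}(w_l)$ if $l+1$ is odd, $w_{l+1}=\mathrm{Compress}_{(l+1)/2}(w_l)$ if $l+1$ is even. Let $\mathrm{Depth}(w)$ be the least $l$ with $|w_l|=1$ ($\infty$ if there is none). The uncompressed parse tree $\overline{\mathcal T}(w)$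 has, for each level $0\le l\le\mathrm{Depth}(w)$ ($l<\infty$), one node for each position of $w_l$; $\mathrm{sig}(v)$ is the symbol at that position; $\mathrm{par}(v)$ is the node on level $l+1$ whose symbol originates from the block of $w_l$ containing $v$; $\mathrm{left}(v)$ and $\mathrm{right}(v)$ are the nodes at the previous and the next position on the same level. Each node represents a fragment of $w$, namely the one that its symbol generates. Let $x,y$ be (possibly empty) strings over $\Sigma$. A node $v$ of $\overline{\mathcal T}(w)$ is preserved in the extension $x\cdot w\cdot y$ if $\overline{\mathcal T}(xwy)$ has a node $v'$ on the same level as $v$ with $\mathrm{sig}(v')=\mathrm{sig}(v)$ that represents the fragment of $xwy$ corresponding to the fragment of $w$ represented by $v$. The node $v$ is context-insensitive if it is preserved in all extensions, left context-insensitive if it is preserved in all extensions with $y$ empty, and right context-insensitive if it is preserved in all extensions with $x$ empty. Let $v$ be a node of $\overline{\mathcal T}(w)$. Each claim below about a node is made provided that the node exists. (a) If $v$ is right context-insensitive, so are $\mathrm{left}(v)$, $\mathrm{left}(\mathrm{par}(v))$ and all children of $v$. Moreover, if $\mathrm{sig}(v)\ne\mathrm{sig}(\mathrm{left}(v))$,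 then $\mathrm{par}(\mathrm{left}(v))$ is also right context-insensitive. (b) If $v$ is left context-insensitive, so are $\mathrm{right}(v)$, $\mathrm{right}(\mathrm{par}(v))$ and all children of $v$. Moreover, if $\mathrm{sig}(v)\ne\mathrm{sig}(\mathrm{right}(v))$, then $\mathrm{par}(\mathrm{right}(v))$ is also left context-insensitive. (c) If $v$ is both left context-insensitive and right context-insensitive, then it is context-insensitive. -/

import Mathlib

namespace ParseTree

/-- The set of symbols over the alphabet `α`: terminals, pairs `(S₁, S₂)` and powers `(S, k)`
with `k ≥ 2`. -/
inductive Sym (α : Type*) where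
  | terminal (a : α) : Sym α
  | pair (S₁ S₂ : Sym α) : Sym α
  | pow (S : Sym α) (k : ℕ) (hk : 2 ≤ k) : Sym α
  deriving DecidableEq

/-- The string generated by a symbol. -/
def Sym.str {α : Type*} : Sym α → List α
  | .terminal a => [a]
  | .pair S₁ S₂ => S₁.str ++ S₂.str
  | .pow S k _ => (List.replicate k S.str).flatten

section Shrink

variable {α : Type*} [DecidableEq α]

/-- The partition of a string of symbols into maximal blocks of equal symbols. -/
def rleBlocks (u : List (Sym α)) : List (List (Sym α)) :=
  u.splitBy fun a b => decide (a = b)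

/-- Each maximal block of `k ≥ 2` equal symbols `S` is replaced by `(S, k)`. -/
def rle (u : List (Sym α)) : List (Sym α) :=
  (rleBlocks u).pmap
    (fun b hb => if hk : 2 ≤ b.length then .pow (b.head hb) b.length hk else b.head hb)
    (fun _ hb => List.ne_nil_of_mem_splitBy hb)

/-- The partition of a string of symbols in which two adjacent symbols `a`, `b` are in a common
block iff `g a = 0` and `g b = 1`; hence all the blocks have length one or two. -/
def compressBlocks (g : Sym α → Bool) (u : List (Sym α)) : List (List (Sym α)) :=
  u.splitBy fun a b => decide (g a = false ∧ g b = true)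

/-- Each block `S₁ S₂` of length two is replaced by `(S₁, S₂)`. -/
def compress (g : Sym α → Bool) (u : List (Sym α)) : List (Sym α) :=
  (compressBlocks g u).pmap
    (fun b hb => if 2 ≤ b.length then .pair (b.head hb) (b.getLast hb) else b.head hb)
    (fun _ hb => List.ne_nil_of_mem_splitBy hb)

/-- The blocks used by the `i`-th shrinking step, `i ≥ 1`. -/
def blocks (h : ℕ → Sym α → Bool) (i : ℕ) (u : List (Sym α)) : List (List (Sym α)) :=
  if Odd i then rleBlocks u else compressBlocks (h (i / 2)) u

/-- The `i`-th shrinking step, `i ≥ 1`. -/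
def shrink (h : ℕ → Sym α → Bool) (i : ℕ) (u : List (Sym α)) : List (Sym α) :=
  if Odd i then rle u else compress (h (i / 2)) u

/-- The string of symbols on level `i` of the representation of `w`. -/
def cshrink (h : ℕ → Sym α → Bool) : ℕ → List α → List (Sym α)
  | 0, w => w.map .terminal
  | i + 1, w => shrink h (i + 1) (cshrink h i w)

/-- The least `i` such that level `i` consists of a single symbol (`⊤` if there is none, which
for random bits `h` has probability zero). -/
noncomputable def depth (h : ℕ → Sym α → Bool) (w : List α) : ℕ∞ :=
  ⨅ (i : ℕ) (_ : (cshrink h i w).length = 1), (i : ℕ∞)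

/-- The nodes of the uncompressed parse tree of `w`: one for each symbol on each of the levels
`0, …, depth h w`. -/
structure Node (h : ℕ → Sym α → Bool) (w : List α) where
  level : ℕ
  pos : ℕ
  level_le : (level : ℕ∞) ≤ depth h w
  pos_lt : pos < (cshrink h level w).length

end Shrink

namespace Node

variable {α : Type*} [DecidableEq α] {h : ℕ → Sym α → Bool} {w : List α}

/-- The symbol (signature) at a node. -/
def sig (v : Node h w) : Sym α := (cshrink h v.level w)[v.pos]'v.pos_lt

/-- `v` represents the fragment of `w` formed by the letters with (zero-based) indices `j` such
that `v.fragStart ≤ j < v.fragEnd`. -/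
def fragStart (v : Node h w) : ℕ :=
  (((cshrink h v.level w).take v.pos).map fun S => S.str.length).sum

/-- See `Node.fragStart`. -/
def fragEnd (v : Node h w) : ℕ := v.fragStart + v.sig.str.length

/-- `u = left(v)`, equivalently `v = right(u)`: the symbol of `u` immediately precedes that of `v`
on the same level. -/
def IsLeftOf (u v : Node h w) : Prop := u.level = v.level ∧ u.pos + 1 = v.pos

/-- `p = par(v)`, equivalently `v` is a child of `p`: the symbol of `v` belongs to the block
(of the string on the level of `v`) from which the symbol of `p` originates. -/
def IsParentOf (p v : Node h w) : Prop :=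
  p.level = v.level + 1 ∧
    (((blocks h (v.level + 1) (cshrink h v.level w)).take p.pos).map List.length).sum ≤ v.pos ∧
    v.pos < (((blocks h (v.level + 1) (cshrink h v.level w)).take (p.pos + 1)).map
      List.length).sum

/-- `v'` is the counterpart of `v` with respect to the extension `x · w · y`: same level, same
signature and corresponding fragment. -/
def IsCounterpart (x y : List α) (v : Node h w) (v' : Node h (x ++ w ++ y)) : Prop :=
  v'.level = v.level ∧ v'.sig = v.sig ∧
    v'.fragStart = x.length + v.fragStart ∧ v'.fragEnd = x.length + v.fragEnd

/-- `v` is preserved in the extension `x · w · y`. -/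
def Preserved (v : Node h w) (x y : List α) : Prop :=
  ∃ v' : Node h (x ++ w ++ y), IsCounterpart x y v v'

def ContextInsensitive (v : Node h w) : Prop := ∀ x y : List α, v.Preserved x y

def LeftContextInsensitive (v : Node h w) : Prop := ∀ x : List α, v.Preserved x []

def RightContextInsensitive (v : Node h w) : Prop := ∀ y : List α, v.Preserved [] y

end Node

end ParseTree

namespace ParseTree

/-! ### Splitting lists into blocks -/

section Lists

variable {β γ : Type*}

/-! A symbol remembers how it was made: `Sym.lev` computes, from the symbol alone, the only level at
which it can have replaced a longer block. Hence `expand` recovers from the symbols on one level the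
blocks of the level below (`parses_shrink`), and since it is injective the blocks determine the
symbols. By induction on the level, fragments on the same level that generate the same string
coincide (`eq_of_str_eq`).

So right context-insensitivity of a node means that the whole prefix of its level up to the node
survives every extension to the right, on a level that still exists there
(`preserved_nil_left_iff`); dually with suffixes on the left. Left neighbours and children then come
from shorter prefixes and from expanding prefixes. To climb one level, use that a block boundary
depends only on the two symbols around it, so boundaries visible inside the surviving prefix survive
too (`Parses.prefix_of_lt`, `Parses.exists_prefix_of_ne`). For (c), the left part of the parse of `x
++ w` and the right part of the parse of `w ++ y` are glued along the common node, level by level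
(`cshrink_two_sided`). -/

theorem splitBy_append_inv {r : β → β → Bool} {U V : List β} {bs₁ bs₂ : List (List β)}
    (hs : (U ++ V).splitBy r = bs₁ ++ bs₂) (hU : bs₁.flatten = U) :
    U.splitBy r = bs₁ ∧ V.splitBy r = bs₂ ∧
      ∀ a ∈ U.getLast?, ∀ b ∈ V.head?, r a b = false := by
  obtain ⟨hf, hn, hc, hl⟩ := List.splitBy_eq_iff.1 hs
  have hV : bs₂.flatten = V := by
    rw [List.flatten_append, hU] at hf
    exact (List.append_cancel_left hf).symm
  simp only [List.mem_append, not_or] at hn hc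
  obtain ⟨hl₁, hl₂, hl₃⟩ := List.isChain_append.1 hl
  refine ⟨List.splitBy_eq_iff.2 ⟨hU.symm, hn.1, fun m hm => hc m (.inl hm), hl₁⟩,
    List.splitBy_eq_iff.2 ⟨hV.symm, hn.2, fun m hm => hc m (.inr hm), hl₂⟩, ?_⟩
  intro a ha b hb
  rcases List.eq_nil_or_concat bs₁ with rfl | ⟨bs, c, rfl⟩
  · simp_all
  rcases bs₂ with _ | ⟨d, ds⟩
  · simp_all
  obtain ⟨h₁, h₂, h₃⟩ := hl₃ c (by simp) d (by simp)
  subst hU hV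
  have h₄ : a = c.getLast h₁ := by
    rw [List.concat_eq_append, List.flatten_append, List.flatten_singleton,
      List.getLast?_append_of_ne_nil _ h₁,
      List.getLast?_eq_getLast_of_ne_nil h₁] at ha
    simpa using ha.symm
  have h₅ : b = d.head h₂ := by
    rw [List.flatten_cons, List.head?_append_of_ne_nil _ h₂, List.head?_eq_some_head h₂] at hb
    simpa using hb.symm
  rw [h₄, h₅, h₃]

theorem map_pmap_eq_self {p : β → Prop} {f : ∀ b, p b → γ} {g : γ → β} {l : List β}
    {H : ∀ b ∈ l, p b} (hg : ∀ b ∈ l, ∀ hb : p b, g (f b hb) = b) : (l.pmap f H).map g = l := by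
  induction l with
  | nil => rfl
  | cons b l ih => simp_all

end Lists

/-! ### Symbols and the blocks they come from -/

section Expand

variable {α : Type*} [DecidableEq α]

/-- Whether two adjacent symbols are put into a common block by the `i`-th shrinking step. -/
def merges (h : ℕ → Sym α → Bool) (i : ℕ) (a b : Sym α) : Bool :=
  if Odd i then decide (a = b) else decide (h (i / 2) a = false ∧ h (i / 2) b = true)

theorem blocks_eq_splitBy (h : ℕ → Sym α → Bool) (i : ℕ) (u : List (Sym α)) :
    blocks h i u = u.splitBy (merges h i) := by
  unfold blocks merges rleBlocks compressBlocks
  split <;> rfl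

/-- The only level at which a symbol can be created from a block of length at least two. -/
noncomputable def Sym.lev (h : ℕ → Sym α → Bool) : Sym α → ℕ
  | .terminal _ => 0
  | .pair a b => sInf {m | ¬ Odd m ∧ a.lev h < m ∧ b.lev h < m ∧ merges h m a b = true}
  | .pow a _ _ => sInf {m | Odd m ∧ a.lev h < m}

theorem not_odd_lev_pair (h : ℕ → Sym α → Bool) (a b : Sym α) :
    ¬ Odd ((Sym.pair a b).lev h) := by
  rw [Sym.lev]
  rcases Set.eq_empty_or_nonempty
    {m | ¬ Odd m ∧ a.lev h < m ∧ b.lev h < m ∧ merges h m a b = true} with hs | hs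
  -- A pair that never arises gets the default level 0, which is even as well.
  · rw [hs, Nat.sInf_empty]
    decide
  · exact (Nat.sInf_mem hs).1

theorem odd_lev_pow (h : ℕ → Sym α → Bool) (a : Sym α) (k : ℕ) (hk : 2 ≤ k) :
    Odd ((Sym.pow a k hk).lev h) := by
  rw [Sym.lev]
  exact (Nat.sInf_mem (s := {m | Odd m ∧ a.lev h < m})
    ⟨2 * a.lev h + 1, by simp, by omega⟩).1

/-- The symbols of the children of a node with a given symbol on level `i`. -/
noncomputable def expand (h : ℕ → Sym α → Bool) (i : ℕ) (S : Sym α) : List (Sym α) :=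
  if S.lev h = i then
    match S with
    | .terminal a => [.terminal a]
    | .pair a b => [a, b]
    | .pow a k _ => List.replicate k a
  else [S]

theorem expand_of_lev_ne {h : ℕ → Sym α → Bool} {i : ℕ} {S : Sym α} (hS : S.lev h ≠ i) :
    expand h i S = [S] := if_neg hS

theorem expand_ne_nil (h : ℕ → Sym α → Bool) (i : ℕ) (S : Sym α) : expand h i S ≠ [] := by
  unfold expand
  split
  · cases S <;> simp
    omega
  · simp

theorem str_expand (h : ℕ → Sym α → Bool) (i : ℕ) (S : Sym α) :
    (expand h i S).flatMap Sym.str = S.str := by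
  unfold expand
  split
  · cases S <;> simp [Sym.str, List.flatMap_def]
  · simp

/-- Only `(a, a)` and `(a, 2)` could be confused, both giving `[a, a]`; the parity of their levels
prevents both from being expanded at the same `i`. An expanded nonterminal has at least two
children, so it differs from an unexpanded symbol. -/
theorem expand_injective (h : ℕ → Sym α → Bool) (i : ℕ) :
    Function.Injective (expand h i) := by
  intro S T hST
  have key : ∀ S T : Sym α, S.lev h = i → T.lev h ≠ i → expand h i S = expand h i T → S = T := by
    intro S T hS hT he
    rw [expand_of_lev_ne hT] at he
    unfold expand at he
    rw [if_pos hS] at he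
    cases S with
    | terminal a => simpa using he
    | pair a b => simp at he
    | pow a k hk =>
      have := congrArg List.length he
      simp at this
      omega
  by_cases hS : S.lev h = i <;> by_cases hT : T.lev h = i
  · have hpair := fun a b => not_odd_lev_pair h (α := α) a b
    have hpow := fun a k hk => odd_lev_pow h (α := α) a k hk
    unfold expand at hST
    rw [if_pos hS, if_pos hT] at hST
    cases S with
    | terminal a =>
      cases T with
      | terminal b => simpa using hST
      | pair a b => simp at hST
      | pow a k hk =>
        have := congrArg List.length hST
        simp at this
        omega
    | pair a b =>
      cases T with
      | terminal b => simp at hST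
      | pair a b => simpa using hST
      | pow c k hk => exact absurd (hpow c k hk) (by rw [hT, ← hS]; exact hpair a b)
    | pow a k hk =>
      cases T with
      | terminal b =>
        have := congrArg List.length hST
        simp at this
        omega
      | pair c d => exact absurd (hpow a k hk) (by rw [hS, ← hT]; exact hpair c d)
      | pow c l hl =>
        rw [List.replicate_inj] at hST
        obtain ⟨rfl, hac⟩ := hST
        rw [hac.resolve_left (by omega)]
  · exact key S T hS hT hST
  · exact (key T S hT hS hST.symm).symm
  · rw [expand_of_lev_ne hS, expand_of_lev_ne hT] at hST
    simpa using hST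

/-- The list `u` of symbols on level `i - 1` is partitioned by the `i`-th shrinking step into the
blocks from which the symbols of `t` originate. -/
def Parses (h : ℕ → Sym α → Bool) (i : ℕ) (u t : List (Sym α)) : Prop :=
  u.splitBy (merges h i) = t.map (expand h i)

/-! ### Locality of block boundaries -/

namespace Parses

variable {h : ℕ → Sym α → Bool} {i : ℕ} {u u' t t' U V T₁ T₂ W : List (Sym α)}

theorem eq_flatMap (p : Parses h i u t) : u = t.flatMap (expand h i) := by
  rw [List.flatMap_def, ← p, List.flatten_splitBy]

theorem unique (p : Parses h i u t) (p' : Parses h i u t') : t = t' :=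
  List.map_injective_iff.2 (expand_injective h i) (p.symm.trans p')

theorem append (p₁ : Parses h i U T₁) (p₂ : Parses h i V T₂)
    (hc : ∀ a ∈ U.getLast?, ∀ b ∈ V.head?, merges h i a b = false) :
    Parses h i (U ++ V) (T₁ ++ T₂) := by
  rw [Parses, List.splitBy_append hc, p₁, p₂, List.map_append]

theorem of_append (p : Parses h i u (T₁ ++ T₂)) :
    Parses h i (T₁.flatMap (expand h i)) T₁ ∧ Parses h i (T₂.flatMap (expand h i)) T₂ ∧
      ∀ a ∈ (T₁.flatMap (expand h i)).getLast?, ∀ b ∈ (T₂.flatMap (expand h i)).head?,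
        merges h i a b = false := by
  obtain rfl := p.eq_flatMap
  rw [Parses, List.flatMap_append, List.map_append] at p
  exact splitBy_append_inv p (List.flatMap_def ..).symm

/-- The source of locality: a boundary is recognised from the two symbols next to it, and the two
sides are then parsed independently. -/
theorem exists_of_cut (p : Parses h i (U ++ V) t)
    (hc : ∀ a ∈ U.getLast?, ∀ b ∈ V.head?, merges h i a b = false) :
    ∃ T₁ T₂, t = T₁ ++ T₂ ∧ Parses h i U T₁ ∧ Parses h i V T₂ := by
  rw [Parses, List.splitBy_append hc, eq_comm, List.map_eq_append_iff] at p
  obtain ⟨T₁, T₂, rfl, h₁, h₂⟩ := p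
  exact ⟨T₁, T₂, rfl, h₁.symm, h₂.symm⟩

/-- Strictness puts the symbol following the expansion of `T₁` inside `W`, so the boundary after
`T₁` is visible in `W` and recurs in `u'`. -/
theorem prefix_of_lt (p : Parses h i u t) (p' : Parses h i u' t') (hW : W <+: u) (hW' : W <+: u')
    (hT : T₁ <+: t) (hl : (T₁.flatMap (expand h i)).length < W.length) : T₁ <+: t' := by
  obtain ⟨T₂, rfl⟩ := hT
  obtain ⟨p₁, p₂, hc⟩ := p.of_append
  have hu := p.eq_flatMap
  rw [List.flatMap_append] at hu
  obtain ⟨R, rfl⟩ : T₁.flatMap (expand h i) <+: W :=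
    List.prefix_of_prefix_length_le (hu ▸ List.prefix_append ..) hW hl.le
  rcases R with _ | ⟨c, R⟩
  · simp at hl
  obtain ⟨V, hV⟩ := hW
  obtain ⟨V', rfl⟩ := hW'
  rw [hu, List.append_assoc] at hV
  rw [← List.append_cancel_left hV] at hc
  rw [List.append_assoc] at p'
  obtain ⟨T₁', T₂', rfl, h₁, -⟩ := p'.exists_of_cut (fun a ha b hb => hc a ha b (by simpa using hb))
  rw [p₁.unique h₁]
  exact List.prefix_append ..

theorem suffix_of_lt (p : Parses h i u t) (p' : Parses h i u' t') (hW : W <:+ u) (hW' : W <:+ u')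
    (hT : T₂ <:+ t) (hl : (T₂.flatMap (expand h i)).length < W.length) : T₂ <:+ t' := by
  obtain ⟨T₁, rfl⟩ := hT
  obtain ⟨p₁, p₂, hc⟩ := p.of_append
  have hu := p.eq_flatMap
  rw [List.flatMap_append] at hu
  obtain ⟨R, rfl⟩ : T₂.flatMap (expand h i) <:+ W :=
    List.suffix_of_suffix_length_le (hu ▸ List.suffix_append ..) hW hl.le
  rcases List.eq_nil_or_concat R with rfl | ⟨R, c, rfl⟩
  · simp at hl
  obtain ⟨V, hV⟩ := hW
  obtain ⟨V', rfl⟩ := hW'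
  rw [hu, ← List.append_assoc] at hV
  rw [← List.append_cancel_right hV] at hc
  rw [← List.append_assoc] at p'
  obtain ⟨T₁', T₂', rfl, -, h₂⟩ := p'.exists_of_cut (fun a ha b hb => hc a (by simpa using ha) b hb)
  rw [p₂.unique h₂]
  exact List.suffix_append ..

/-- The block of `a` ends within the common prefix. Distinct symbols can merge only in a pairing
step; then `b` has bit 1, cannot open a pair, and the cut is after `b`. Otherwise the cut is between
`a` and `b`. -/
theorem exists_prefix_of_ne {a b : Sym α} (hab : a ≠ b) (p : Parses h i u t)
    (p' : Parses h i u' t') (hu : U ++ [a, b] <+: u) (hu' : U ++ [a, b] <+: u') :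
    ∃ T, T <+: t ∧ T <+: t' ∧ U.length < (T.flatMap (expand h i)).length := by
  by_cases hm : merges h i a b = true
  · have hcut : ∀ c, merges h i b c = false := by
      intro c
      unfold merges at hm ⊢
      split at hm <;> simp_all
    obtain ⟨V, rfl⟩ := hu
    obtain ⟨V', rfl⟩ := hu'
    have hc : ∀ V : List (Sym α), ∀ x ∈ (U ++ [a, b]).getLast?, ∀ y ∈ V.head?,
        merges h i x y = false := by
      intro V x hx y _
      obtain rfl : b = x := by simpa using hx
      exact hcut y
    obtain ⟨T₁, T₂, rfl, h₁, -⟩ := p.exists_of_cut (hc V)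
    obtain ⟨T₁', T₂', rfl, h₁', -⟩ := p'.exists_of_cut (hc V')
    obtain rfl := h₁.unique h₁'
    exact ⟨T₁, List.prefix_append .., List.prefix_append .., by simp [← h₁.eq_flatMap]⟩
  · obtain ⟨V, rfl⟩ := id hu
    rw [show U ++ [a, b] ++ V = (U ++ [a]) ++ (b :: V) by simp] at p
    obtain ⟨T₁, T₂, rfl, h₁, -⟩ := p.exists_of_cut (by simpa using hm)
    refine ⟨T₁, List.prefix_append .., ?_, by simp [← h₁.eq_flatMap]⟩
    exact p.prefix_of_lt (W := U ++ [a, b]) p' ⟨V, by simp⟩ hu' (List.prefix_append ..)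
      (by simp [← h₁.eq_flatMap])

/-- Mirror image: if `a` and `b` merge, then `a` has bit 0 and cannot close a pair, so there is a
cut before `a`. -/
theorem exists_suffix_of_ne {a b : Sym α} (hab : a ≠ b) (p : Parses h i u t)
    (p' : Parses h i u' t') (hu : a :: b :: U <:+ u) (hu' : a :: b :: U <:+ u') :
    ∃ T, T <:+ t ∧ T <:+ t' ∧ U.length < (T.flatMap (expand h i)).length := by
  by_cases hm : merges h i a b = true
  · have hcut : ∀ c, merges h i c a = false := by
      intro c
      unfold merges at hm ⊢
      split at hm <;> simp_all
    obtain ⟨V, rfl⟩ := hu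
    obtain ⟨V', rfl⟩ := hu'
    have hc : ∀ V : List (Sym α), ∀ x ∈ V.getLast?, ∀ y ∈ (a :: b :: U).head?,
        merges h i x y = false := by
      intro V x _ y hy
      obtain rfl : a = y := by simpa using hy
      exact hcut x
    obtain ⟨T₁, T₂, rfl, -, h₂⟩ := p.exists_of_cut (hc V)
    obtain ⟨T₁', T₂', rfl, -, h₂'⟩ := p'.exists_of_cut (hc V')
    obtain rfl := h₂.unique h₂'
    exact ⟨T₂, List.suffix_append .., List.suffix_append .., by simp [← h₂.eq_flatMap]⟩
  · obtain ⟨V, rfl⟩ := id hu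
    rw [show V ++ a :: b :: U = (V ++ [a]) ++ (b :: U) by simp] at p
    obtain ⟨T₁, T₂, rfl, -, h₂⟩ := p.exists_of_cut (by simpa using hm)
    refine ⟨T₂, List.suffix_append .., ?_, by simp [← h₂.eq_flatMap]⟩
    exact p.suffix_of_lt (W := a :: b :: U) p' ⟨V, by simp⟩ hu' (List.suffix_append ..)
      (by simp [← h₂.eq_flatMap])

end Parses

/-- The properties of the string on level `l` from which it follows that each symbol determines
its children: no symbol is newer than `l`, and no two adjacent symbols should have been merged
earlier. -/
structure IsLevel (h : ℕ → Sym α → Bool) (l : ℕ) (u : List (Sym α)) : Prop where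
  lev_le : ∀ S ∈ u, S.lev h ≤ l
  isChain : u.IsChain fun a b =>
    ∀ m, a.lev h < m → b.lev h < m → m ≤ l → merges h m a b = false

theorem IsLevel.of_infix {h : ℕ → Sym α → Bool} {l : ℕ} {u v : List (Sym α)}
    (hu : IsLevel h l u) (hv : v <:+: u) : IsLevel h l v :=
  ⟨fun S hS => hu.lev_le S (hv.subset hS), hu.isChain.infix hv⟩

/-- The level of the power is exactly `l + 1`: at any earlier odd level above that of `a`, two
adjacent copies of `a` would already have been merged, against `IsLevel`. -/
theorem expand_pow {h : ℕ → Sym α → Bool} {l k : ℕ} {a : Sym α} (hk : 2 ≤ k) (hl : Odd (l + 1))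
    (hu : IsLevel h l (List.replicate k a)) :
    expand h (l + 1) (.pow a k hk) = List.replicate k a := by
  have hlev : (Sym.pow a k hk).lev h = l + 1 := by
    have ha : a.lev h ≤ l := hu.lev_le a (by simp; omega)
    rw [Sym.lev]
    refine le_antisymm (Nat.sInf_le ⟨hl, by omega⟩) ?_
    refine le_csInf ⟨l + 1, hl, by omega⟩ ?_
    rintro m ⟨hm, ham⟩
    by_contra hlt
    obtain ⟨j, rfl⟩ := Nat.exists_eq_add_of_le' hk
    have := hu.isChain
    rw [List.replicate_succ, List.replicate_succ, List.isChain_cons_cons] at this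
    simpa [merges, hm] using this.1 m ham ham (by omega)
  rw [expand, if_pos hlev]

theorem expand_pair {h : ℕ → Sym α → Bool} {l : ℕ} {a b : Sym α} (hl : ¬ Odd (l + 1))
    (hu : IsLevel h l [a, b]) (hm : merges h (l + 1) a b = true) :
    expand h (l + 1) (.pair a b) = [a, b] := by
  have hlev : (Sym.pair a b).lev h = l + 1 := by
    have ha : a.lev h ≤ l := hu.lev_le a (by simp)
    have hb : b.lev h ≤ l := hu.lev_le b (by simp)
    rw [Sym.lev]
    refine le_antisymm (Nat.sInf_le ⟨hl, by omega, by omega, hm⟩) ?_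
    refine le_csInf ⟨l + 1, hl, by omega, by omega, hm⟩ ?_
    rintro m ⟨-, ham, hbm, hmm⟩
    by_contra hlt
    have := (List.isChain_cons_cons.1 hu.isChain).1 m ham hbm (by omega)
    simp [this] at hmm
  rw [expand, if_pos hlev]

theorem parses_shrink {h : ℕ → Sym α → Bool} {l : ℕ} {u : List (Sym α)} (hu : IsLevel h l u) :
    Parses h (l + 1) u (shrink h (l + 1) u) := by
  have hinf : ∀ b ∈ u.splitBy (merges h (l + 1)), IsLevel h l b := fun b hb =>
    hu.of_infix (by simpa using List.infix_of_mem_flatten hb)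
  have hone : ∀ a, IsLevel h l [a] → expand h (l + 1) a = [a] := fun a ha =>
    expand_of_lev_ne (by have := ha.lev_le a (by simp); omega)
  unfold Parses
  have hbl := blocks_eq_splitBy h (l + 1) u
  unfold blocks at hbl
  by_cases hl : Odd (l + 1)
  · rw [if_pos hl] at hbl
    rw [shrink, if_pos hl, rle]
    rw [← hbl]
    refine (map_pmap_eq_self fun b hb hne => ?_).symm
    rw [hbl] at hb
    have hlev := hinf b hb
    have hch := List.isChain_of_mem_splitBy hb
    rcases b with _ | ⟨a, b⟩
    · exact absurd rfl hne
    have hrep : a :: b = List.replicate (a :: b).length a := by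
      refine List.isChain_eq_iff_eq_replicate.1 (hch.imp fun x y hxy => ?_) a (by simp)
      simpa [merges, hl] using hxy
    split
    · rename_i hk
      have := expand_pow (a := a) hk hl (hrep ▸ hlev)
      simp only [List.head_cons]
      rw [this, ← hrep]
    · rename_i hk
      obtain rfl : b = [] := List.length_eq_zero_iff.1 (by rw [List.length_cons] at hk; omega)
      simp [hone a hlev]
  · rw [if_neg hl] at hbl
    rw [shrink, if_neg hl, compress]
    rw [← hbl]
    refine (map_pmap_eq_self fun b hb hne => ?_).symm
    rw [hbl] at hb
    have hlev := hinf b hb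
    have hch := List.isChain_of_mem_splitBy hb
    match b, hne with
    | [a], _ => simp [hone a hlev]
    | [a, b], _ =>
      simp [expand_pair hl hlev (List.isChain_cons_cons.1 hch).1]
    -- The middle symbol would need both bits, so no block has three symbols.
    | a :: b :: c :: d, _ =>
      simp only [merges, hl, if_false, decide_eq_true_eq, List.isChain_cons_cons] at hch
      simp [hch.1.2] at hch

theorem isLevel_shrink {h : ℕ → Sym α → Bool} {l : ℕ} {u : List (Sym α)} (hu : IsLevel h l u) :
    IsLevel h (l + 1) (shrink h (l + 1) u) := by
  have p := parses_shrink hu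
  generalize shrink h (l + 1) u = t at p
  have hut := p.eq_flatMap
  refine ⟨fun S hS => ?_, ?_⟩
  · by_cases hlev : S.lev h = l + 1
    · exact hlev.le
    · refine (hu.lev_le S ?_).trans (Nat.le_succ l)
      rw [hut, List.mem_flatMap]
      exact ⟨S, hS, by simp [expand_of_lev_ne hlev]⟩
  · rw [List.isChain_iff_forall_rel_of_append_cons_cons]
    rintro a b A B rfl m ha hb hm
    -- Both symbols are older than `m`, hence were kept by this step and were already adjacent in
    -- `u`. For `m = l + 1` they lie in different blocks; for smaller `m` the invariant of `u`
    -- applies.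
    have ha' := expand_of_lev_ne (h := h) (i := l + 1) (S := a) (by omega)
    have hb' := expand_of_lev_ne (h := h) (i := l + 1) (S := b) (by omega)
    rcases Nat.lt_or_ge l m with hlm | hlm
    · obtain rfl : m = l + 1 := by omega
      rw [show A ++ a :: b :: B = (A ++ [a]) ++ b :: B by simp] at p
      exact p.of_append.2.2 a (by simp [ha']) b (by simp [hb'])
    · exact List.isChain_iff_forall_rel_of_append_cons_cons.1 hu.isChain
        (l₁ := A.flatMap (expand h (l + 1))) (l₂ := B.flatMap (expand h (l + 1)))
        (by simp [hut, ha', hb']) m ha hb hlm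

theorem isLevel_cshrink (h : ℕ → Sym α → Bool) (l : ℕ) (w : List α) :
    IsLevel h l (cshrink h l w) := by
  induction l with
  | zero =>
    refine ⟨by simp [cshrink, Sym.lev], ?_⟩
    refine List.Pairwise.isChain (List.pairwise_of_forall fun a b m ha _ hm => ?_)
    omega
  | succ l ih => exact isLevel_shrink ih

/-! ### Consecutive levels and the strings they generate -/

theorem parses_cshrink (h : ℕ → Sym α → Bool) (l : ℕ) (w : List α) :
    Parses h (l + 1) (cshrink h l w) (cshrink h (l + 1) w) :=
  parses_shrink (isLevel_cshrink h l w)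

theorem blocks_cshrink (h : ℕ → Sym α → Bool) (l : ℕ) (w : List α) :
    blocks h (l + 1) (cshrink h l w) = (cshrink h (l + 1) w).map (expand h (l + 1)) := by
  rw [blocks_eq_splitBy, parses_cshrink]

theorem length_le_length_flatMap_expand (h : ℕ → Sym α → Bool) (i : ℕ) (t : List (Sym α)) :
    t.length ≤ (t.flatMap (expand h i)).length := by
  induction t with
  | nil => simp
  | cons S t ih =>
    have := List.length_pos_iff.2 (expand_ne_nil h i S)
    simp only [List.flatMap_cons, List.length_append, List.length_cons]
    omega

theorem str_flatMap_expand (h : ℕ → Sym α → Bool) (i : ℕ) (t : List (Sym α)) :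
    (t.flatMap (expand h i)).flatMap Sym.str = t.flatMap Sym.str := by
  simp [List.flatMap_assoc, str_expand]

theorem str_cshrink (h : ℕ → Sym α → Bool) (l : ℕ) (w : List α) :
    (cshrink h l w).flatMap Sym.str = w := by
  induction l with
  | zero => simp [cshrink, List.flatMap_map, Sym.str]
  | succ l ih => rw [← str_flatMap_expand h (l + 1), ← (parses_cshrink h l w).eq_flatMap, ih]

/-- Fragments of strings on level `l` that generate the same string are equal. -/
theorem eq_of_str_eq {h : ℕ → Sym α → Bool} {l : ℕ} {w w' : List α}
    {P A Q P' A' Q' : List (Sym α)} (hw : cshrink h l w = P ++ (A ++ Q))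
    (hw' : cshrink h l w' = P' ++ (A' ++ Q')) (hA : A.flatMap Sym.str = A'.flatMap Sym.str) :
    A = A' := by
  induction l generalizing P A Q P' A' Q' with
  | zero =>
    have key : ∀ (w : List α) (P A Q : List (Sym α)), cshrink h 0 w = P ++ (A ++ Q) →
        A = (A.flatMap Sym.str).map .terminal := by
      intro w P A Q hw
      rw [cshrink, List.map_eq_append_iff] at hw
      obtain ⟨_, _, rfl, -, hw⟩ := hw
      rw [List.map_eq_append_iff] at hw
      obtain ⟨x, _, rfl, rfl, -⟩ := hw
      simp [List.flatMap_map, Sym.str]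
    rw [key w P A Q hw, key w' P' A' Q' hw', hA]
  | succ l ih =>
    have p := parses_cshrink h l w
    have p' := parses_cshrink h l w'
    rw [hw] at p
    rw [hw'] at p'
    have he := ih (P := P.flatMap (expand h (l + 1))) (Q := Q.flatMap (expand h (l + 1)))
      (P' := P'.flatMap (expand h (l + 1))) (Q' := Q'.flatMap (expand h (l + 1)))
      (A := A.flatMap (expand h (l + 1))) (A' := A'.flatMap (expand h (l + 1)))
      (by simp [p.eq_flatMap]) (by simp [p'.eq_flatMap]) (by simp only [str_flatMap_expand, hA])
    have q := p.of_append.2.1.of_append.1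
    have q' := p'.of_append.2.1.of_append.1
    rw [he] at q
    exact q.unique q'

/-- A fragment that survives an extension on either side survives the two-sided extension. -/
theorem cshrink_two_sided {h : ℕ → Sym α → Bool} {l : ℕ} {w x y : List α}
    {A M B A₁ B₁ : List (Sym α)} (hM : M ≠ []) (hw : cshrink h l w = A ++ (M ++ B))
    (hy : cshrink h l (w ++ y) = A ++ (M ++ B₁)) (hx : cshrink h l (x ++ w) = A₁ ++ (M ++ B)) :
    cshrink h l (x ++ w ++ y) = A₁ ++ (M ++ B₁) := by
  induction l generalizing A M B A₁ B₁ with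
  | zero =>
    simp only [cshrink, List.map_append] at *
    rw [hw, ← List.append_assoc] at hx
    rw [hw, List.append_assoc] at hy
    rw [← List.append_cancel_right hx, hw, List.append_assoc, List.append_assoc, hy,
      List.append_assoc]
  | succ l ih =>
    have p := parses_cshrink h l w
    have py := parses_cshrink h l (w ++ y)
    have px := parses_cshrink h l (x ++ w)
    have pxy := parses_cshrink h l (x ++ w ++ y)
    rw [hw] at p
    rw [hy] at py
    rw [hx] at px
    have hM' : M.flatMap (expand h (l + 1)) ≠ [] := by
      rw [← List.length_pos_iff] at hM ⊢
      exact hM.trans_le (length_le_length_flatMap_expand ..)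
    have he := ih (A := A.flatMap (expand h (l + 1))) (B := B.flatMap (expand h (l + 1)))
      (A₁ := A₁.flatMap (expand h (l + 1))) (B₁ := B₁.flatMap (expand h (l + 1))) hM'
      (by simp [p.eq_flatMap]) (by simp [py.eq_flatMap]) (by simp [px.eq_flatMap])
    rw [he] at pxy
    -- The boundary before `M` in `x ++ w` involves only the first symbol of the nonempty expansion
    -- of `M`, so it persists when `B` is replaced by `B₁`.
    have q := px.of_append.2.2
    rw [List.flatMap_append, List.head?_append_of_ne_nil _ hM'] at q
    refine pxy.unique (px.of_append.1.append ?_ ?_)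
    · have := py.of_append.2.1
      rwa [List.flatMap_append] at this
    · rwa [List.head?_append_of_ne_nil _ hM']

end Expand

end ParseTree

namespace ParseTree

/-! ### Existence of levels -/

section Depth

variable {α : Type*} [DecidableEq α] {h : ℕ → Sym α → Bool} {w : List α} {l : ℕ}

theorem le_depth_iff : (l : ℕ∞) ≤ depth h w ↔ ∀ i, (cshrink h i w).length = 1 → l ≤ i := by
  simp [depth, le_iInf_iff]

theorem length_cshrink_succ_le (h : ℕ → Sym α → Bool) (l : ℕ) (w : List α) :
    (cshrink h (l + 1) w).length ≤ (cshrink h l w).length := by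
  rw [(parses_cshrink h l w).eq_flatMap]
  exact length_le_length_flatMap_expand ..

theorem length_cshrink_eq_one_of_le {i : ℕ} (hi : (cshrink h i w).length = 1) (hil : i ≤ l) :
    (cshrink h l w).length = 1 := by
  induction l, hil using Nat.le_induction with
  | base => exact hi
  | succ l _ ih =>
    refine le_antisymm (ih ▸ length_cshrink_succ_le h l w) ?_
    rw [Nat.succ_le_iff, List.length_pos_iff]
    intro h0
    have := (parses_cshrink h l w).eq_flatMap
    simp [h0] at this
    simp [this] at ih

theorem succ_le_depth (hl : (l : ℕ∞) ≤ depth h w) (h1 : (cshrink h l w).length ≠ 1) :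
    ((l + 1 : ℕ) : ℕ∞) ≤ depth h w := by
  rw [le_depth_iff] at hl ⊢
  intro i hi
  refine Nat.succ_le_of_lt (lt_of_le_of_ne (hl i hi) ?_)
  rintro rfl
  exact h1 hi

end Depth

/-! ### Preservation of nodes -/

namespace Node

variable {α : Type*} [DecidableEq α] {h : ℕ → Sym α → Bool} {w : List α}

theorem cshrink_eq (v : Node h w) : cshrink h v.level w =
    (cshrink h v.level w).take v.pos ++ v.sig :: (cshrink h v.level w).drop (v.pos + 1) := by
  rw [sig, List.cons_getElem_drop_succ, List.take_append_drop]

theorem fragStart_eq (v : Node h w) :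
    v.fragStart = (((cshrink h v.level w).take v.pos).flatMap Sym.str).length := by
  rw [fragStart, List.length_flatMap]

theorem exists_node_of_cshrink_eq {l : ℕ} {A B : List (Sym α)} {S : Sym α}
    (hd : (l : ℕ∞) ≤ depth h w) (he : cshrink h l w = A ++ S :: B) :
    ∃ v : Node h w, v.level = l ∧ v.sig = S ∧ v.fragStart = (A.flatMap Sym.str).length :=
  ⟨⟨l, A.length, hd, by simp [he]⟩, rfl, by simp [sig, he], by rw [fragStart_eq]; simp [he]⟩

theorem preserved_iff {v : Node h w} {x y : List α} : v.Preserved x y ↔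
    (v.level : ℕ∞) ≤ depth h (x ++ w ++ y) ∧ ∃ A B,
      cshrink h v.level (x ++ w ++ y) = A ++ v.sig :: B ∧
      (A.flatMap Sym.str).length = x.length + v.fragStart := by
  constructor
  · rintro ⟨v', hl, hs, hf, -⟩
    refine ⟨hl ▸ v'.level_le, (cshrink h v.level (x ++ w ++ y)).take v'.pos,
      (cshrink h v.level (x ++ w ++ y)).drop (v'.pos + 1), ?_, ?_⟩
    · have := v'.cshrink_eq
      rwa [hs, hl] at this
    · rw [← hf, fragStart_eq, hl]
  · rintro ⟨hd, A, B, he, hA⟩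
    obtain ⟨v', hl, hs, hf⟩ := exists_node_of_cshrink_eq hd he
    exact ⟨v', hl, hs, hf.trans hA, by rw [fragEnd, fragEnd, hs, hf, hA, Nat.add_assoc]⟩

/-- The symbols before a node and those before its counterpart generate the same string, so they are
equal by `eq_of_str_eq`. -/
theorem preserved_nil_left_iff {v : Node h w} {y : List α} : v.Preserved [] y ↔
    (v.level : ℕ∞) ≤ depth h (w ++ y) ∧
      (cshrink h v.level w).take (v.pos + 1) <+: cshrink h v.level (w ++ y) := by
  have ht : (cshrink h v.level w).take (v.pos + 1) =
      (cshrink h v.level w).take v.pos ++ [v.sig] := by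
    rw [sig, List.take_append_getElem]
  rw [preserved_iff, List.nil_append]
  refine and_congr_right fun _ => ⟨?_, ?_⟩
  · rintro ⟨A, B, he, hA⟩
    have h₁ := str_cshrink h v.level w
    have h₂ := str_cshrink h v.level (w ++ y)
    rw [v.cshrink_eq, List.flatMap_append] at h₁
    rw [he, List.flatMap_append] at h₂
    have hAeq := (List.append_inj (h₂.trans ((congrArg (· ++ y) h₁.symm).trans
      (List.append_assoc ..))) (by simpa [fragStart_eq] using hA)).1
    have := eq_of_str_eq (P := []) (P' := []) (h := h) he v.cshrink_eq hAeq
    rw [ht, he, this]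
    exact ⟨B, by simp⟩
  · rintro ⟨B, hB⟩
    exact ⟨(cshrink h v.level w).take v.pos, B, by rw [← hB, ht]; simp, by simp [fragStart_eq]⟩

theorem preserved_nil_right_iff {v : Node h w} {x : List α} : v.Preserved x [] ↔
    (v.level : ℕ∞) ≤ depth h (x ++ w) ∧
      (cshrink h v.level w).drop v.pos <:+ cshrink h v.level (x ++ w) := by
  have ht : (cshrink h v.level w).drop v.pos =
      v.sig :: (cshrink h v.level w).drop (v.pos + 1) := by
    rw [sig, List.cons_getElem_drop_succ]
  have h₁ := str_cshrink h v.level w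
  have h₂ := str_cshrink h v.level (x ++ w)
  rw [v.cshrink_eq, List.flatMap_append] at h₁
  rw [preserved_iff, List.append_nil]
  refine and_congr_right fun _ => ⟨?_, ?_⟩
  · rintro ⟨A, B, he, hA⟩
    rw [he, List.flatMap_append] at h₂
    have hB := (List.append_inj (h₂.trans ((congrArg (x ++ ·) h₁.symm).trans
      (List.append_assoc ..).symm)) (by simpa [fragStart_eq] using hA)).2
    have := eq_of_str_eq (Q := []) (Q' := []) (h := h) (by rw [List.append_nil]; exact he)
      (by rw [List.append_nil]; exact v.cshrink_eq) hB
    rw [ht, he, this]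
    exact ⟨A, rfl⟩
  · rintro ⟨A, hA⟩
    refine ⟨A, (cshrink h v.level w).drop (v.pos + 1), by rw [← hA, ht], ?_⟩
    rw [← hA, ht] at h₂
    have e₁ := congrArg List.length h₁
    have e₂ := congrArg List.length h₂
    simp only [List.flatMap_append, List.length_append, ← fragStart_eq] at e₁ e₂
    omega

theorem isParentOf_iff {p v : Node h w} : p.IsParentOf v ↔ p.level = v.level + 1 ∧
    (((cshrink h (v.level + 1) w).take p.pos).flatMap (expand h (v.level + 1))).length ≤ v.pos ∧
    v.pos <
      (((cshrink h (v.level + 1) w).take (p.pos + 1)).flatMap (expand h (v.level + 1))).length := by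
  simp only [IsParentOf, blocks_cshrink, ← List.map_take, List.flatMap_def, List.length_flatten]

theorem RightContextInsensitive.left {u v : Node h w} (hv : v.RightContextInsensitive)
    (huv : u.IsLeftOf v) : u.RightContextInsensitive := by
  intro y
  obtain ⟨hd, hp⟩ := preserved_nil_left_iff.1 (hv y)
  obtain ⟨hl, hpos⟩ := huv
  rw [preserved_nil_left_iff, hl]
  exact ⟨hd, (List.take_prefix_take_left (by omega)).trans hp⟩

theorem LeftContextInsensitive.right {u v : Node h w} (hv : v.LeftContextInsensitive)
    (huv : v.IsLeftOf u) : u.LeftContextInsensitive := by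
  intro x
  obtain ⟨hd, hp⟩ := preserved_nil_right_iff.1 (hv x)
  obtain ⟨hl, hpos⟩ := huv
  rw [preserved_nil_right_iff, ← hl]
  exact ⟨hd, (List.drop_suffix_drop_left _ (by omega)).trans hp⟩

theorem RightContextInsensitive.child {c v : Node h w} (hv : v.RightContextInsensitive)
    (hc : v.IsParentOf c) : c.RightContextInsensitive := by
  intro y
  obtain ⟨hd, hp⟩ := preserved_nil_left_iff.1 (hv y)
  obtain ⟨hl, -, hlt⟩ := isParentOf_iff.1 hc
  rw [hl] at hd hp
  rw [preserved_nil_left_iff]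
  refine ⟨le_trans (by exact_mod_cast Nat.le_succ _) hd, ?_⟩
  have hw := (parses_cshrink h c.level w).eq_flatMap
  have hwy := (parses_cshrink h c.level (w ++ y)).eq_flatMap
  have h₁ := hp.flatMap (expand h (c.level + 1))
  rw [← hwy] at h₁
  have h₂ := (List.take_prefix (v.pos + 1) (cshrink h (c.level + 1) w)).flatMap
    (expand h (c.level + 1))
  rw [← hw] at h₂
  refine (List.prefix_of_prefix_length_le (List.take_prefix _ _) h₂ ?_).trans h₁
  rw [List.length_take]
  omega

theorem LeftContextInsensitive.child {c v : Node h w} (hv : v.LeftContextInsensitive)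
    (hc : v.IsParentOf c) : c.LeftContextInsensitive := by
  intro x
  obtain ⟨hd, hp⟩ := preserved_nil_right_iff.1 (hv x)
  obtain ⟨hl, hle, -⟩ := isParentOf_iff.1 hc
  rw [hl] at hd hp
  rw [preserved_nil_right_iff]
  refine ⟨le_trans (by exact_mod_cast Nat.le_succ _) hd, ?_⟩
  have hw := (parses_cshrink h c.level w).eq_flatMap
  have hxw := (parses_cshrink h c.level (x ++ w)).eq_flatMap
  have h₁ := hp.flatMap (expand h (c.level + 1))
  rw [← hxw] at h₁
  have h₂ := (List.drop_suffix v.pos (cshrink h (c.level + 1) w)).flatMap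
    (expand h (c.level + 1))
  rw [← hw] at h₂
  refine (List.suffix_of_suffix_length_le (List.drop_suffix _ _) h₂ ?_).trans h₁
  have := congrArg List.length hw
  rw [← List.take_append_drop v.pos (cshrink h (c.level + 1) w), List.flatMap_append,
    List.length_append] at this
  rw [List.length_drop]
  omega

theorem RightContextInsensitive.left_parent {p u v : Node h w} (hv : v.RightContextInsensitive)
    (hp : p.IsParentOf v) (hu : u.IsLeftOf p) : u.RightContextInsensitive := by
  intro y
  obtain ⟨hd, hpre⟩ := preserved_nil_left_iff.1 (hv y)
  obtain ⟨hl, hle, -⟩ := isParentOf_iff.1 hp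
  obtain ⟨hul, hpos⟩ := hu
  rw [preserved_nil_left_iff, hul, hl, hpos]
  have hlen := hpre.length_le
  have hvp := v.pos_lt
  rw [List.length_take] at hlen
  -- The nonempty blocks of the nodes before `p` precede `v`, so `v.pos ≥ 1`: the level of `v` has
  -- at least two symbols in the extension, and the next level exists.
  refine ⟨succ_le_depth hd ?_, (parses_cshrink h v.level w).prefix_of_lt
    (parses_cshrink h v.level (w ++ y)) (List.take_prefix _ _) hpre (List.take_prefix _ _) ?_⟩
  · have h₁ := length_le_length_flatMap_expand h (v.level + 1)
      ((cshrink h (v.level + 1) w).take p.pos)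
    have h₂ := hl ▸ p.pos_lt
    rw [List.length_take] at h₁
    omega
  · rw [List.length_take]
    omega

theorem LeftContextInsensitive.right_parent {p u v : Node h w} (hv : v.LeftContextInsensitive)
    (hp : p.IsParentOf v) (hu : p.IsLeftOf u) : u.LeftContextInsensitive := by
  intro x
  obtain ⟨hd, hsuf⟩ := preserved_nil_right_iff.1 (hv x)
  obtain ⟨hl, -, hlt⟩ := isParentOf_iff.1 hp
  obtain ⟨hul, hpos⟩ := hu
  rw [preserved_nil_right_iff, ← hul, hl, ← hpos]
  have hlen := hsuf.length_le
  have hvp := v.pos_lt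
  rw [List.length_drop] at hlen
  have h₃ := congrArg List.length (parses_cshrink h v.level w).eq_flatMap
  rw [← List.take_append_drop (p.pos + 1) (cshrink h (v.level + 1) w), List.flatMap_append,
    List.length_append] at h₃
  refine ⟨succ_le_depth hd ?_, (parses_cshrink h v.level w).suffix_of_lt
    (parses_cshrink h v.level (x ++ w)) (List.drop_suffix _ _) hsuf (List.drop_suffix _ _) ?_⟩
  · have h₁ := length_le_length_flatMap_expand h (v.level + 1)
      ((cshrink h (v.level + 1) w).drop (p.pos + 1))
    have h₂ := u.pos_lt
    rw [← hul, hl] at h₂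
    rw [List.length_drop] at h₁
    omega
  · rw [List.length_drop]
    omega

theorem RightContextInsensitive.parent_left {p u v : Node h w} (hv : v.RightContextInsensitive)
    (hu : u.IsLeftOf v) (hne : v.sig ≠ u.sig) (hp : p.IsParentOf u) :
    p.RightContextInsensitive := by
  intro y
  obtain ⟨hd, hpre⟩ := preserved_nil_left_iff.1 (hv y)
  obtain ⟨hl, hle, -⟩ := isParentOf_iff.1 hp
  obtain ⟨hul, hpos⟩ := hu
  have hup := u.pos_lt
  have hvp := v.pos_lt
  have htake : (cshrink h u.level w).take u.pos ++ [u.sig, v.sig] =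
      (cshrink h u.level w).take (v.pos + 1) := by
    rw [← List.take_append_getElem (by rwa [hul])]
    simp only [← hpos]
    rw [← List.take_append_getElem hup, List.append_assoc, List.singleton_append]
    simp only [sig, hul, hpos]
  rw [← hul] at hd hpre hvp
  rw [preserved_nil_left_iff, hl]
  refine ⟨succ_le_depth hd ?_, ?_⟩
  · have hlen := hpre.length_le
    rw [List.length_take] at hlen
    omega
  · obtain ⟨T, hT, hT', hlt⟩ := Parses.exists_prefix_of_ne hne.symm
      (parses_cshrink h u.level w) (parses_cshrink h u.level (w ++ y))
      (htake ▸ List.take_prefix _ _) (htake ▸ hpre)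
    refine (List.prefix_of_prefix_length_le (List.take_prefix _ _) hT ?_).trans hT'
    -- Otherwise `T` stops before `p`, and its expansion has at most `u.pos` symbols, contradicting
    -- `hlt`.
    by_contra hcon
    rw [List.length_take] at hcon
    have := ((List.prefix_of_prefix_length_le hT (List.take_prefix p.pos _) (by
      rw [List.length_take]; have := hT.length_le; omega)).flatMap
        (expand h (u.level + 1))).length_le
    rw [List.length_take] at hlt
    omega

theorem LeftContextInsensitive.parent_right {p u v : Node h w} (hv : v.LeftContextInsensitive)
    (hu : v.IsLeftOf u) (hne : v.sig ≠ u.sig) (hp : p.IsParentOf u) :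
    p.LeftContextInsensitive := by
  intro x
  obtain ⟨hd, hsuf⟩ := preserved_nil_right_iff.1 (hv x)
  obtain ⟨hl, -, hgt⟩ := isParentOf_iff.1 hp
  obtain ⟨hul, hpos⟩ := hu
  have hup := u.pos_lt
  have hvp := v.pos_lt
  have hdrop : v.sig :: u.sig :: (cshrink h u.level w).drop (u.pos + 1) =
      (cshrink h u.level w).drop v.pos := by
    rw [sig, sig, List.cons_getElem_drop_succ]
    simp only [← hpos, ← hul]
    rw [List.cons_getElem_drop_succ]
  rw [hul] at hd hsuf hvp
  rw [preserved_nil_right_iff, hl]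
  refine ⟨succ_le_depth hd ?_, ?_⟩
  · have hlen := hsuf.length_le
    rw [List.length_drop] at hlen
    omega
  · obtain ⟨T, hT, hT', hlt⟩ := Parses.exists_suffix_of_ne hne
      (parses_cshrink h u.level w) (parses_cshrink h u.level (x ++ w))
      (hdrop ▸ List.drop_suffix _ _) (hdrop ▸ hsuf)
    refine (List.suffix_of_suffix_length_le (List.drop_suffix _ _) hT ?_).trans hT'
    by_contra hcon
    rw [List.length_drop] at hcon
    have := ((List.suffix_of_suffix_length_le hT (List.drop_suffix (p.pos + 1) _) (by
      rw [List.length_drop]; omega)).flatMap (expand h (u.level + 1))).length_le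
    have h₃ := congrArg List.length (parses_cshrink h u.level w).eq_flatMap
    rw [← List.take_append_drop (p.pos + 1) (cshrink h (u.level + 1) w), List.flatMap_append,
      List.length_append] at h₃
    rw [List.length_drop] at hlt
    omega

theorem contextInsensitive_of_left_of_right {v : Node h w} (hl : v.LeftContextInsensitive)
    (hr : v.RightContextInsensitive) : v.ContextInsensitive := by
  intro x y
  obtain ⟨-, A₁, hA₁⟩ := preserved_nil_right_iff.1 (hl x)
  obtain ⟨-, B₁, hB₁⟩ := preserved_nil_left_iff.1 (hr y)
  have hw := v.cshrink_eq
  have hdrop : (cshrink h v.level w).drop v.pos =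
      [v.sig] ++ (cshrink h v.level w).drop (v.pos + 1) := by
    rw [sig, List.singleton_append, List.cons_getElem_drop_succ]
  have htake : (cshrink h v.level w).take (v.pos + 1) =
      (cshrink h v.level w).take v.pos ++ [v.sig] := by
    rw [sig, List.take_append_getElem]
  rw [hdrop] at hA₁
  rw [htake, List.append_assoc] at hB₁
  have hxy := cshrink_two_sided (by simp) hw hB₁.symm hA₁.symm
  have sw := congrArg List.length (str_cshrink h v.level w)
  have sx := congrArg List.length (str_cshrink h v.level (x ++ w))
  have sy := congrArg List.length (str_cshrink h v.level (w ++ y))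
  rw [hw] at sw
  rw [← hA₁] at sx
  rw [← hB₁] at sy
  have hf := v.fragStart_eq
  simp only [List.flatMap_append, List.flatMap_cons, List.length_append, List.flatMap_nil,
    List.append_nil] at sw sx sy
  refine preserved_iff.2 ⟨?_, A₁, B₁, hxy, by omega⟩
  rw [le_depth_iff]
  intro i hi
  -- If the extension collapsed to one symbol too early, the level of `v` would be that symbol
  -- alone; comparing lengths forces `x` and `y` to be empty, contradicting that `v` is a node for
  -- `w`.
  by_contra hlt
  have h1 := length_cshrink_eq_one_of_le hi (Nat.le_of_not_le hlt)
  rw [hxy] at h1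
  simp only [List.length_append, List.length_cons, List.length_nil] at h1
  obtain rfl : A₁ = [] := List.length_eq_zero_iff.1 (by omega)
  obtain rfl : B₁ = [] := List.length_eq_zero_iff.1 (by omega)
  simp only [List.flatMap_nil, List.length_nil] at sx sy
  obtain rfl : x = [] := List.length_eq_zero_iff.1 (by omega)
  obtain rfl : y = [] := List.length_eq_zero_iff.1 (by omega)
  rw [List.nil_append, List.append_nil] at hi
  exact hlt (le_depth_iff.1 v.level_le i hi)

end Node

end ParseTree

theorem mainTheorem11 {α : Type*} [DecidableEq α] (h : ℕ → ParseTree.Sym α → Bool)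
    (w : List α) (v : ParseTree.Node h w) :
    (v.RightContextInsensitive →
      (∀ u : ParseTree.Node h w, u.IsLeftOf v → u.RightContextInsensitive) ∧
      (∀ p u : ParseTree.Node h w, p.IsParentOf v → u.IsLeftOf p → u.RightContextInsensitive) ∧
      (∀ c : ParseTree.Node h w, v.IsParentOf c → c.RightContextInsensitive) ∧
      (∀ u p : ParseTree.Node h w, u.IsLeftOf v → v.sig ≠ u.sig → p.IsParentOf u →
        p.RightContextInsensitive)) ∧
    (v.LeftContextInsensitive →
      (∀ u : ParseTree.Node h w, v.IsLeftOf u → u.LeftContextInsensitive) ∧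
      (∀ p u : ParseTree.Node h w, p.IsParentOf v → p.IsLeftOf u → u.LeftContextInsensitive) ∧
      (∀ c : ParseTree.Node h w, v.IsParentOf c → c.LeftContextInsensitive) ∧
      (∀ u p : ParseTree.Node h w, v.IsLeftOf u → v.sig ≠ u.sig → p.IsParentOf u →
        p.LeftContextInsensitive)) ∧
    (v.LeftContextInsensitive → v.RightContextInsensitive → v.ContextInsensitive) := by
  exact ⟨fun hv => ⟨fun _ hu => hv.left hu, fun _ _ hp hu => hv.left_parent hp hu,
      fun _ hc => hv.child hc, fun _ _ hu hne hp => hv.parent_left hu hne hp⟩,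
    fun hv => ⟨fun _ hu => hv.right hu, fun _ _ hp hu => hv.right_parent hp hu,
      fun _ hc => hv.child hc, fun _ _ hu hne hp => hv.parent_right hu hne hp⟩,
    ParseTree.Node.contextInsensitive_of_left_of_right⟩
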